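/- **Corollary (single input, $\kappa$-pruning).** Let $L\ge 0$ be the number of hidden layers, $d_{\mathrm{in}}\ge1$, $\sigma_b\ge 0$, $\sigma_v>0$, and let $\phi:\mathbb R\to\mathbb R$ be positive homogeneous: $\phi(\gamma x)=\gamma\phi(x)$ for all $\gamma>0$, $x\in\mathbb R$. For widths $\mathbf p=(p_1,\dots,p_L)$ and an input $\mathbf x\in\mathbb R^{d_{\mathrm{in}}}$ consider the random network $$Z^{(1)}_k=\sum_{j=1}^{d_{\mathrm{in}}}\tfrac1{\sqrt{d_{\mathrm{in}}}}V^{(1)}_{jk}x_j+B^{(1)}_k,\qquad Z^{(l+1)}_k=\sum_{j=1}^{p_l}\sqrt{\lambda^{(l)}_{p_l,j}}\,V^{(l+1)}_{jk}\,\phi(Z^{(l)}_j)+B^{(l+1)}_k\quad(1\le l\le L),$$ where $V^{(l)}_{jk}\sim\mathcal N(0,\sigma_v^2)$, $B^{(l)}_k\sim\mathcal N(0,\sigma_b^2)$ (equal to $0$ if $\sigma_b=0$), $\lambda^{(l)}_{p_l,j}\sim\mu^{(l)}_{p_l}$ for some probability distributions $\mu^{(l)}_{p}$ on $[0,\infty)$,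 and for each $\mathbf p$ all the variables $\lambda^{(l)}_{p_l,j},V^{(l)}_{jk},B^{(l)}_k$ are independent. For $\kappa\in(0,1)$ the $\kappa$-pruned network $Z^{*(l)}_k$ is defined by $Z^{*(1)}_k=Z^{(1)}_k$ and $$Z^{*(l+1)}_k=\sum_{j=1}^{p_l}\sqrt{\lambda^{(l)}_{p_l,j}}\;\mathbf 1_{\{\lambda^{(l)}_{p_l,j}>\lambda^{(l)}_{p_l,(\lfloor\kappa p_l\rfloor)}\}}\,V^{(l+1)}_{jk}\,\phi(Z^{*(l)}_j)+B^{(l+1)}_k ,$$ where $\lambda^{(l)}_{p,(1)}\ge\dots\ge\lambda^{(l)}_{p,(p)}$ are the ordered values of $\lambda^{(l)}_{p,1},\dots,\lambda^{(l)}_{p,p}$ (and all nodes of layer $l$ are pruned if $\lfloor\kappa p_l\rfloor=0$). Assume that for every $l=1,\dots,L$ there are $a^{(l)}\ge 0$ and a measure $\rho^{(l)}$ on $(0,\infty)$ with $\int\min(1,u)\,\rho^{(l)}(du)<\infty$ such that 1. as $p\to\infty$, $\sum_{j=1}^{p}\lambda^{(l)}_{p,j}$ converges in distribution to the infinitely divisible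 law $\mathrm{ID}(a^{(l)},\rho^{(l)})$ on $[0,\infty)$ with Laplace transform $t\mapsto\exp\bigl(-ta^{(l)}-\int_0^\infty(1-e^{-wt})\rho^{(l)}(dw)\bigr)$; 2. $a^{(l)}=0$; 3. (UI) $M^{(l)}_1:=\int_0^\infty u\,\rho^{(l)}(du)<\infty$, $N^{(l)}_p:=\mathbf E\bigl[\sum_{j=1}^{p}\lambda^{(l)}_{p,j}\bigr]<\infty$ for all $p$, and $N^{(l)}_p\to a^{(l)}+M^{(l)}_1$ as $p\to\infty$. Then, for every input $\mathbf x$, every $\kappa\in(0,1)$, every $l=1,\dots,L$ and every $k\ge1$, $$\mathbf E\Bigl[\bigl|Z^{(l+1)}_k(\mathbf x;\mathbf p)-Z^{*(l+1)}_k(\mathbf x;\mathbf p)\bigr|^2\Bigr]\to0\qquad\text{as }\min(p_1,\dots,p_L)\to\infty .$$ -/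

import Mathlib

open MeasureTheory ProbabilityTheory Filter Topology
open scoped NNReal ENNReal

namespace PrunedFFNN

noncomputable section

/-- `φ (γ x) = γ φ x` for all `γ > 0` and all real `x`. -/
def PositiveHomogeneous (φ : ℝ → ℝ) : Prop :=
  ∀ γ : ℝ, 0 < γ → ∀ x : ℝ, φ (γ * x) = γ * φ x

/-- A Lévy measure on `(0, ∞)`, viewed as a measure on `[0, ∞)` without mass at `0`:
it integrates `min (1, x)`. -/
structure IsLevyMeasure (ρ : Measure ℝ≥0) : Prop where
  zero_eq : ρ {0} = 0
  lintegral_min_ne_top : ∫⁻ u, ((min 1 u : ℝ≥0) : ℝ≥0∞) ∂ρ ≠ ∞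

/-- `ν` is the infinitely divisible law `ID(a, ρ)` on `[0, ∞)`: for all `t ≥ 0`, its Laplace
transform at `t` is `exp (-t a - ∫ (1 - exp (-w t)) ρ(dw))`. -/
def IsIDLaw (a : ℝ≥0) (ρ ν : Measure ℝ≥0) : Prop :=
  ∀ t : ℝ≥0, ∫ u : ℝ≥0, Real.exp (-((t : ℝ) * u)) ∂ν =
    Real.exp (-((t : ℝ) * a) - ∫ w : ℝ≥0, (1 - Real.exp (-((w : ℝ) * t))) ∂ρ)

/-- The row sums of the triangular array `X n 0, …, X n (n - 1)` converge in distribution to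
`ID(a, ρ)` as `n → ∞`. -/
def RowSumsTendstoID {Ω : Type*} [MeasurableSpace Ω] (P : Measure Ω) [IsProbabilityMeasure P]
    (X : (n : ℕ) → Fin n → Ω → ℝ≥0) (a : ℝ≥0) (ρ : Measure ℝ≥0) : Prop :=
  ∃ ν : ProbabilityMeasure ℝ≥0, IsIDLaw a ρ (ν : Measure ℝ≥0) ∧
    TendstoInDistribution (fun (n : ℕ) (ω : Ω) => ∑ j, X n j ω) atTop
      (id : ℝ≥0 → ℝ≥0) (fun _ => P) (ν : Measure ℝ≥0)

/-- With `M = ∫ u ρ(du)` and `N n = E[∑ j, X n j]`: `M` is finite, every `N n` is finite, and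
`N n → a + M` as `n → ∞`. -/
structure MeanCondition {Ω : Type*} [MeasurableSpace Ω] (P : Measure Ω)
    (X : (n : ℕ) → Fin n → Ω → ℝ≥0) (a : ℝ≥0) (ρ : Measure ℝ≥0) : Prop where
  levy_mean_ne_top : ∫⁻ u, (u : ℝ≥0∞) ∂ρ ≠ ∞
  mean_ne_top : ∀ n, ∫⁻ ω, ∑ j, (X n j ω : ℝ≥0∞) ∂P ≠ ∞
  tendsto_mean : Tendsto (fun n => ∫⁻ ω, ∑ j, (X n j ω : ℝ≥0∞) ∂P) atTop
    (𝓝 ((a : ℝ≥0∞) + ∫⁻ u, (u : ℝ≥0∞) ∂ρ))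

/-- Pre-activations of a feedforward network with `L` hidden layers of widths `p` and input `x`.
Hidden layer number `l + 1` is `l : Fin L`. The value at `l : Fin (L + 1)` is the pre-activation
`Z^(l+1)`, so that `0` is the first hidden layer and `Fin.last L` the output layer.
`W₁ j k` is the weight from input `j` to node `k`, and `W l j k` the weight from node `j` of
hidden layer `l` to node `k` of the next layer. -/
def preactivation {L din : ℕ} (φ : ℝ → ℝ) (p : Fin L → ℕ)
    (W₁ : Fin din → ℕ → ℝ) (W : (l : Fin L) → Fin (p l) → ℕ → ℝ)
    (B : Fin (L + 1) → ℕ → ℝ) (x : Fin din → ℝ) : Fin (L + 1) → ℕ → ℝ :=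
  Fin.induction (motive := fun _ => ℕ → ℝ)
    (fun k => ∑ j, W₁ j k * x j + B 0 k)
    (fun l Z k => ∑ j, W l j k * φ (Z j) + B l.succ k)

/-- The `m`-th largest entry of `v`, for `1 ≤ m ≤ n` (counted with repetitions). For `m = 0` and
`n > 0` it is the maximum; then nothing lies above the threshold, as for `m = 1`. -/
def orderStat {n : ℕ} (v : Fin n → ℝ≥0) (m : ℕ) : ℝ≥0 :=
  if h : m - 1 < n then v (Tuple.sort v (Fin.rev ⟨m - 1, h⟩)) else 0

/-- The threshold of `κ`-pruning: the `⌊κ n⌋`-th largest of the node variances. -/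
def kappaThreshold (κ : ℝ) {n : ℕ} (v : Fin n → ℝ≥0) : ℝ≥0 :=
  orderStat v ⌊κ * n⌋₊

/-- The random variables of the model.
`lam l n j` is the variance of node `j` of hidden layer `l` when that layer has width `n`,
`V l j k` is the Gaussian factor of the weight from node `j` into node `k` of layer `l + 1`, and
`B l k` is the bias of node `k` of layer `l + 1`. Nodes are numbered from `0`; the factors and
biases are indexed by all natural numbers, and each network uses those that its widths require. -/
structure IsModel {Ω : Type*} [MeasurableSpace Ω] (P : Measure Ω) {L : ℕ} (σb σv : ℝ≥0)
    (μ : Fin L → ℕ → Measure ℝ≥0)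
    (lam : (l : Fin L) → (n : ℕ) → Fin n → Ω → ℝ≥0)
    (V : Fin (L + 1) → ℕ → ℕ → Ω → ℝ) (B : Fin (L + 1) → ℕ → Ω → ℝ) : Prop where
  measurable_lam : ∀ l n j, Measurable (lam l n j)
  measurable_V : ∀ l j k, Measurable (V l j k)
  measurable_B : ∀ l k, Measurable (B l k)
  law_lam : ∀ l n j, HasLaw (lam l n j) (μ l n) P
  law_V : ∀ l j k, HasLaw (V l j k) (gaussianReal 0 (σv ^ 2)) P
  law_B : ∀ l k, HasLaw (B l k) (gaussianReal 0 (σb ^ 2)) P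
  /-- For every choice of widths, all variables of the network are mutually independent. -/
  indep : ∀ p : Fin L → ℕ,
    iIndepFun
      (Sum.elim (fun (i : Σ l : Fin L, Fin (p l)) (ω : Ω) => (lam i.1 (p i.1) i.2 ω : ℝ))
        (Sum.elim (fun (i : Fin (L + 1) × ℕ × ℕ) => V i.1 i.2.1 i.2.2)
          (fun (i : Fin (L + 1) × ℕ) => B i.1 i.2))) P

section Networks

variable {Ω : Type*} {L din : ℕ} (φ : ℝ → ℝ)
  (lam : (l : Fin L) → (n : ℕ) → Fin n → Ω → ℝ≥0)
  (V : Fin (L + 1) → ℕ → ℕ → Ω → ℝ) (B : Fin (L + 1) → ℕ → Ω → ℝ)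
  (x : Fin din → ℝ) (p : Fin L → ℕ)

/-- The unpruned network: weights `√(1 / din) V` on the inputs and `√λ V` afterwards. -/
def unpruned (ω : Ω) : Fin (L + 1) → ℕ → ℝ :=
  preactivation φ p
    (fun j k => Real.sqrt (1 / (din : ℝ)) * V 0 j k ω)
    (fun l j k => Real.sqrt (lam l (p l) j ω) * V l.succ j k ω)
    (fun l k => B l k ω) x

/-- The `κ`-pruned network: in each hidden layer the outgoing weights of the nodes with
variance at most the `κ`-threshold of that layer are set to zero. -/
def kappaPruned (κ : ℝ) (ω : Ω) : Fin (L + 1) → ℕ → ℝ :=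
  preactivation φ p
    (fun j k => Real.sqrt (1 / (din : ℝ)) * V 0 j k ω)
    (fun l j k =>
      (if kappaThreshold κ (fun i => lam l (p l) i ω) < lam l (p l) j ω
        then Real.sqrt (lam l (p l) j ω) else 0) * V l.succ j k ω)
    (fun l k => B l k ω) x

end Networks

end

end PrunedFFNN

namespace PrunedFFNN

/-! ### Order statistics -/

/-! The second moment of the pruning error obeys a recursion over the layers. Given everything up to
layer `l`, the next Gaussian factors are centred and orthogonal, and the node variances of layer `l`
are independent of its pre-activations. With `K` a Lipschitz constant of `φ` this gives E_{l+1} ≤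
σv² K² (N E_l + R M_l): here N is the mean row sum, R the mean variance lost to pruning
(`tendsto_prunedMass`), and M_l bounds the unpruned second moments. The first layer has no error, N
and M_l stay bounded, so R → 0 suffices (`IsModel.maxError_succ_le`, `IsModel.tendsto_maxError`).

For R → 0, split the pruned variances at a level 1/t. Those below it have mean sum at most
(2/t)(-log E e^{-tS}), S being the row sum; this tends to 2ψ(t)/t as the width grows, with ψ the
Laplace exponent, and ψ(t)/t → 0 as t → ∞ because there is no drift (`lintegral_sum_small_le`,
`tendsto_laplaceExponent_div`). A pruned variance above 1/t forces at least ⌊κn⌋ entries above 1/t,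
a number tending to infinity, which is too many for a bounded mean (`lintegral_sum_large_le`). -/

theorem measurable_orderStat {n : ℕ} (m : ℕ) :
    Measurable (fun v : Fin n → ℝ≥0 => orderStat v m) := by
  unfold orderStat
  split_ifs with h
  · intro s hs
    -- The sorting permutation takes finitely many values; on each piece the order statistic is a
    -- fixed coordinate.
    have hset : (fun v : Fin n → ℝ≥0 => v (Tuple.sort v (Fin.rev ⟨m - 1, h⟩))) ⁻¹' s =
        ⋃ σ : Equiv.Perm (Fin n), {v | σ = Tuple.sort v} ∩
          (fun v : Fin n → ℝ≥0 => v (σ (Fin.rev ⟨m - 1, h⟩))) ⁻¹' s := by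
      ext v
      simp
    rw [hset]
    refine MeasurableSet.iUnion fun σ => MeasurableSet.inter ?_ ((measurable_pi_apply _) hs)
    simp only [Tuple.eq_sort_iff, Monotone, Function.comp_apply, Set.ofPred_and, Set.ofPred_forall]
    refine MeasurableSet.inter ?_ ?_
    · refine MeasurableSet.iInter fun i => MeasurableSet.iInter fun j => MeasurableSet.iInter
        fun _ => measurableSet_le (measurable_pi_apply _) (measurable_pi_apply _)
    · refine MeasurableSet.iInter fun i => MeasurableSet.iInter fun j => MeasurableSet.iInter
        fun _ => ?_
      have : {v : Fin n → ℝ≥0 | v (σ i) = v (σ j) → σ i < σ j} =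
          {v | v (σ i) = v (σ j)}ᶜ ∪ {_v | σ i < σ j} := by
        ext v
        simp only [Set.mem_ofPred_eq, Set.mem_union, Set.mem_compl_iff]
        tauto
      rw [this]
      exact (measurableSet_eq_fun (f := fun v : Fin n → ℝ≥0 => v (σ i))
        (g := fun v : Fin n → ℝ≥0 => v (σ j)) (measurable_pi_apply _)
        (measurable_pi_apply _)).compl.union
        (MeasurableSet.const _)
  · exact measurable_const

theorem measurable_kappaThreshold (κ : ℝ) (n : ℕ) :
    Measurable (fun v : Fin n → ℝ≥0 => kappaThreshold κ v) :=
  measurable_orderStat _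

theorem le_card_of_lt_orderStat {n m : ℕ} {v : Fin n → ℝ≥0} {ε : ℝ≥0} (hm : 1 ≤ m)
    (h : ε < orderStat v m) : m ≤ (Finset.univ.filter fun i => ε < v i).card := by
  unfold orderStat at h
  split_ifs at h with hmn
  · set r : Fin n := Fin.rev ⟨m - 1, hmn⟩ with hr
    -- The position `r` is `n - m`, so `m` sorted positions remain from it upwards. This uses `1 ≤
    -- m`, since `m - 1` is truncated at zero.
    have hcard : (Finset.Ici r).card = m := by
      rw [Fin.card_Ici, hr, Fin.val_rev]
      simp only
      omega
    rw [← hcard]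
    refine Finset.card_le_card_of_injOn (Tuple.sort v) ?_ (Tuple.sort v).injective.injOn
    intro i hi
    simp only [Finset.coe_Ici, Set.mem_Ici] at hi
    simp only [Finset.coe_filter, Finset.mem_univ, true_and, Set.mem_ofPred_eq]
    exact h.trans_le (Tuple.monotone_sort v hi)
  · simp at h

/-! ### The small entries of a row -/

theorem half_le_one_sub_exp_neg {y : ℝ} (h0 : 0 ≤ y) (h1 : y ≤ 1) :
    y / 2 ≤ 1 - Real.exp (-y) := by
  have h2 : Real.exp (-y) ≤ 1 / (1 + y) := by
    rw [Real.exp_neg, ← one_div]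
    exact one_div_le_one_div_of_le (by linarith) (by linarith [Real.add_one_le_exp y])
  have h3 : 1 / (1 + y) ≤ 1 - y / 2 := by
    rw [div_le_iff₀ (by linarith)]
    nlinarith
  linarith

section Row

variable {Ω : Type*} [MeasurableSpace Ω] {P : Measure Ω}

theorem integrable_exp_neg [IsProbabilityMeasure P]
    {Y : Ω → ℝ≥0} (hY : Measurable Y) (t : ℝ≥0) :
    Integrable (fun ω => Real.exp (-((t : ℝ) * Y ω))) P := by
  refine Integrable.of_bound (by fun_prop) 1 (ae_of_all _ fun ω => ?_)
  rw [Real.norm_eq_abs, Real.abs_exp, Real.exp_le_one_iff]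
  exact neg_nonpos.2 (by positivity)

/-- If tX ≤ 1 then X ≤ (2/t)(1 - e^{-tX}). Since 1 - y ≤ -log y, the sum over the row is controlled
by a sum of logarithms, which independence turns into the logarithm of the Laplace transform of the
row sum. -/
theorem lintegral_sum_small_le [IsProbabilityMeasure P]
    {n : ℕ} {X : Fin n → Ω → ℝ≥0} (hX : ∀ j, Measurable (X j))
    (hind : iIndepFun X P) {t : ℝ≥0} (ht : 0 < t) :
    ∫⁻ ω, ∑ j, (if t * X j ω ≤ 1 then (X j ω : ℝ≥0∞) else 0) ∂P ≤
      ENNReal.ofReal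
        (2 / t * -Real.log (∫ ω, Real.exp (-((t : ℝ) * ((∑ j, X j ω : ℝ≥0) : ℝ))) ∂P)) := by
  have ht' : (0 : ℝ) < t := ht
  set E : Fin n → ℝ := fun j => ∫ ω, Real.exp (-((t : ℝ) * X j ω)) ∂P with hE
  have hEpos : ∀ j, 0 < E j := fun j => integral_exp_pos (integrable_exp_neg (hX j) t)
  have hprod : ∫ ω, Real.exp (-((t : ℝ) * ((∑ j, X j ω : ℝ≥0) : ℝ))) ∂P = ∏ j, E j := by
    have hind' : iIndepFun (fun j ω => (X j ω : ℝ)) P :=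
      hind.comp (fun _ => ((↑) : ℝ≥0 → ℝ)) (fun _ => measurable_coe_nnreal_real)
    have := hind'.mgf_sum (t := -(t : ℝ)) (fun j => (hX j).coe_nnreal_real) Finset.univ
    simp only [mgf, Finset.sum_apply, neg_mul] at this
    simpa only [NNReal.coe_sum] using this
  have hterm : ∀ j, ∫⁻ ω, (if t * X j ω ≤ 1 then (X j ω : ℝ≥0∞) else 0) ∂P ≤
      ENNReal.ofReal (2 / t * (1 - E j)) := by
    intro j
    have hint : Integrable (fun ω => 2 / (t : ℝ) * (1 - Real.exp (-((t : ℝ) * X j ω)))) P :=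
      ((integrable_const 1).sub (integrable_exp_neg (hX j) t)).const_mul _
    have hval : ∫ ω, 2 / (t : ℝ) * (1 - Real.exp (-((t : ℝ) * X j ω))) ∂P = 2 / t * (1 - E j) := by
      rw [integral_const_mul, integral_sub (integrable_const 1) (integrable_exp_neg (hX j) t)]
      simp [hE]
    have hnn : ∀ ω, 0 ≤ 2 / (t : ℝ) * (1 - Real.exp (-((t : ℝ) * X j ω))) := fun ω => by
      have : Real.exp (-((t : ℝ) * X j ω)) ≤ 1 :=
        Real.exp_le_one_iff.2 (neg_nonpos.2 (by positivity))
      exact mul_nonneg (by positivity) (by linarith)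
    rw [← hval, ofReal_integral_eq_lintegral_ofReal hint (ae_of_all _ hnn)]
    refine lintegral_mono fun ω => ?_
    simp only
    split_ifs with h
    · rw [← ENNReal.ofReal_coe_nnreal]
      refine ENNReal.ofReal_le_ofReal ?_
      have h' : (t : ℝ) * X j ω ≤ 1 := by exact_mod_cast h
      have := half_le_one_sub_exp_neg (by positivity) h'
      calc (X j ω : ℝ) = 2 / t * (t * X j ω / 2) := by field_simp
        _ ≤ _ := by gcongr
    · exact zero_le
  have hm : ∀ j, Measurable fun ω => (if t * X j ω ≤ 1 then (X j ω : ℝ≥0∞) else 0) := fun j =>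
    Measurable.ite (measurableSet_le ((hX j).const_mul t) measurable_const)
      (hX j).coe_nnreal_ennreal measurable_const
  have hE1 : ∀ j, E j ≤ 1 := fun j => by
    have : E j ≤ ∫ _, (1 : ℝ) ∂P := integral_mono (integrable_exp_neg (hX j) t)
      (integrable_const 1) fun ω => Real.exp_le_one_iff.2 (neg_nonpos.2 (by positivity))
    simpa using this
  rw [lintegral_finsetSum _ fun j _ => hm j]
  calc ∑ j, ∫⁻ ω, (if t * X j ω ≤ 1 then (X j ω : ℝ≥0∞) else 0) ∂P
      ≤ ∑ j, ENNReal.ofReal (2 / t * (1 - E j)) := Finset.sum_le_sum fun j _ => hterm j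
    _ = ENNReal.ofReal (∑ j, 2 / t * (1 - E j)) := by
      rw [ENNReal.ofReal_sum_of_nonneg]
      exact fun j _ => mul_nonneg (by positivity) (by linarith [hE1 j])
    _ ≤ _ := by
      refine ENNReal.ofReal_le_ofReal ?_
      rw [hprod, Real.log_prod fun j _ => (hEpos j).ne', ← Finset.mul_sum, ← Finset.sum_neg_distrib]
      gcongr with j
      linarith [Real.log_le_sub_one_of_pos (hEpos j)]

/-! ### The entries of a row above a fixed level -/

/-- With `m + 2` entries above `ε`, every `j` has at least `m + 1` others above `ε`, so the sum of
the `X i` over `i ≠ j` is at least `ε * (m + 1)`. Only products with `i ≠ j` arise; they factor by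
independence, so first moments suffice. -/
theorem lintegral_sum_large_le {n : ℕ} {X : Fin n → Ω → ℝ≥0} (hX : ∀ j, Measurable (X j))
    (hind : iIndepFun X P) (ε : ℝ≥0) (hε : 0 < ε) (m : ℕ) :
    ∫⁻ ω, ∑ j, (if m + 2 ≤ (Finset.univ.filter fun i => ε < X i ω).card
        then (X j ω : ℝ≥0∞) else 0) ∂P ≤
      (∫⁻ ω, ∑ j, (X j ω : ℝ≥0∞) ∂P) ^ 2 / (ε * (m + 1 : ℕ)) := by
  have hXe : ∀ j, Measurable fun ω => (X j ω : ℝ≥0∞) := fun j => (hX j).coe_nnreal_ennreal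
  have hXXe : ∀ i j, Measurable fun ω => (X i ω : ℝ≥0∞) * X j ω := fun i j => (hXe i).mul (hXe j)
  have hc0 : (ε * (m + 1 : ℕ) : ℝ≥0∞) ≠ 0 :=
    mul_ne_zero (by exact_mod_cast hε.ne') (by exact_mod_cast m.succ_ne_zero)
  have hct : (ε * (m + 1 : ℕ) : ℝ≥0∞) ≠ ∞ :=
    ENNReal.mul_ne_top ENNReal.coe_ne_top (ENNReal.natCast_ne_top _)
  have hpt : ∀ ω j, (if m + 2 ≤ (Finset.univ.filter fun i => ε < X i ω).card
        then (X j ω : ℝ≥0∞) else 0) ≤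
      (∑ i ∈ Finset.univ.erase j, (X j ω : ℝ≥0∞) * X i ω) / (ε * (m + 1 : ℕ)) := by
    intro ω j
    split_ifs with h
    · rw [ENNReal.le_div_iff_mul_le (Or.inl hc0) (Or.inl hct), ← Finset.mul_sum]
      gcongr
      set s := (Finset.univ.filter fun i => ε < X i ω).erase j with hs
      have hcard : m + 1 ≤ s.card := by
        have h1 : _ - 1 ≤ s.card := Finset.pred_card_le_card_erase
        omega
      calc (ε * (m + 1 : ℕ) : ℝ≥0∞) ≤ ε * s.card := by gcongr
        _ = ∑ _i ∈ s, (ε : ℝ≥0∞) := by rw [Finset.sum_const, nsmul_eq_mul, mul_comm]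
        _ ≤ ∑ i ∈ s, (X i ω : ℝ≥0∞) := by
          refine Finset.sum_le_sum fun i hi => ?_
          simp only [hs, Finset.mem_erase, Finset.mem_filter] at hi
          exact_mod_cast hi.2.2.le
        _ ≤ _ := Finset.sum_le_sum_of_subset (Finset.erase_subset_erase _ (Finset.filter_subset _ _))
    · exact zero_le
  calc _ ≤ ∫⁻ ω, ∑ j, (∑ i ∈ Finset.univ.erase j, (X j ω : ℝ≥0∞) * X i ω) /
          (ε * (m + 1 : ℕ)) ∂P :=
        lintegral_mono fun ω => Finset.sum_le_sum fun j _ => hpt ω j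
    _ = (∑ j, ∑ i ∈ Finset.univ.erase j, (∫⁻ ω, X j ω ∂P) * ∫⁻ ω, X i ω ∂P) /
          (ε * (m + 1 : ℕ)) := by
        simp only [div_eq_mul_inv, ← Finset.sum_mul]
        rw [lintegral_mul_const' _ _ (ENNReal.inv_ne_top.2 hc0), lintegral_finsetSum _ fun j _ =>
          Finset.measurable_fun_sum _ fun i _ => hXXe j i]
        congr 1
        refine Finset.sum_congr rfl fun j _ => ?_
        rw [lintegral_finsetSum _ fun i _ => hXXe j i]
        refine Finset.sum_congr rfl fun i hi => ?_
        exact lintegral_mul_eq_lintegral_mul_lintegral_of_indepFun (hXe j) (hXe i)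
          ((hind.indepFun (Finset.ne_of_mem_erase hi).symm).comp measurable_coe_nnreal_ennreal
            measurable_coe_nnreal_ennreal)
    -- The diagonal is restored only now, as squares of means and not as second moments.
    _ ≤ (∑ j, ∑ i, (∫⁻ ω, X j ω ∂P) * ∫⁻ ω, X i ω ∂P) / (ε * (m + 1 : ℕ)) := by
        gcongr
        exact Finset.subset_univ _
    _ = _ := by
        rw [lintegral_finsetSum _ fun j _ => hXe j, sq, Finset.sum_mul_sum]

/-! ### The Laplace exponent -/

/-- Dominated convergence: the integrand is at most 2/t, hence tends to zero, and is dominated by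
2w, which the finite mean makes integrable. -/
theorem tendsto_laplaceExponent_div {ρ : Measure ℝ≥0} (hρ : ∫⁻ u, (u : ℝ≥0∞) ∂ρ ≠ ∞) :
    Tendsto (fun t : ℕ => 2 / (t : ℝ) * ∫ w : ℝ≥0, (1 - Real.exp (-((w : ℝ) * (t : ℝ)))) ∂ρ)
      atTop (𝓝 0) := by
  have hint : Integrable (fun w : ℝ≥0 => 2 * (w : ℝ)) ρ := by
    refine Integrable.const_mul ⟨by fun_prop, ?_⟩ _
    simpa [HasFiniteIntegral, lt_top_iff_ne_top] using hρ
  simp_rw [← integral_const_mul]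
  rw [show (0 : ℝ) = ∫ _w : ℝ≥0, (0 : ℝ) ∂ρ by simp]
  have hnn : ∀ (t : ℕ) (w : ℝ≥0), 0 ≤ 1 - Real.exp (-((w : ℝ) * (t : ℝ))) := fun t w =>
    sub_nonneg.2 (Real.exp_le_one_iff.2 (neg_nonpos.2 (by positivity)))
  refine tendsto_integral_of_dominated_convergence _ (fun t => by fun_prop) hint
    (fun t => ae_of_all _ fun w => ?_) (ae_of_all _ fun w => ?_)
  · rw [Real.norm_of_nonneg (mul_nonneg (by positivity) (hnn t w))]
    rcases t.eq_zero_or_pos with rfl | ht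
    · simp
    · have : (0 : ℝ) < t := by exact_mod_cast ht
      calc 2 / (t : ℝ) * (1 - Real.exp (-((w : ℝ) * (t : ℝ)))) ≤ 2 / t * (w * t) := by
            gcongr
            linarith [Real.add_one_le_exp (-((w : ℝ) * (t : ℝ)))]
        _ = 2 * w := by field_simp
  · refine squeeze_zero (fun t => mul_nonneg (by positivity) (hnn t w)) (fun t => ?_)
      (tendsto_const_div_atTop_nhds_zero_nat 2)
    exact mul_le_of_le_one_right (by positivity) (by linarith [Real.exp_pos (-((w : ℝ) * (t : ℝ)))])

/-- Weak convergence is tested on the bounded continuous function u ↦ e^{-tu}; the limit is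
positive, so the logarithm is continuous there. -/
theorem RowSumsTendstoID.tendsto_log_laplace [IsProbabilityMeasure P]
    {X : (n : ℕ) → Fin n → Ω → ℝ≥0} {ρ : Measure ℝ≥0}
    (h : RowSumsTendstoID P X 0 ρ) (t : ℝ≥0) :
    Tendsto (fun n => -Real.log (∫ ω, Real.exp (-((t : ℝ) * ((∑ j, X n j ω : ℝ≥0) : ℝ))) ∂P))
      atTop (𝓝 (∫ w : ℝ≥0, (1 - Real.exp (-((w : ℝ) * t))) ∂ρ)) := by
  obtain ⟨ν, hν, hd⟩ := h
  let g : BoundedContinuousFunction ℝ≥0 ℝ :=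
    BoundedContinuousFunction.ofNormedAddCommGroup (fun u : ℝ≥0 => Real.exp (-((t : ℝ) * u)))
      (by fun_prop) 1 fun u => by
        rw [Real.norm_eq_abs, Real.abs_exp, Real.exp_le_one_iff]
        exact neg_nonpos.2 (by positivity)
  have hg := (ProbabilityMeasure.tendsto_iff_forall_integral_tendsto.1 hd.tendsto) g
  have hlim : Tendsto (fun n => ∫ ω, Real.exp (-((t : ℝ) * ((∑ j, X n j ω : ℝ≥0) : ℝ))) ∂P) atTop
      (𝓝 (Real.exp (-∫ w : ℝ≥0, (1 - Real.exp (-((w : ℝ) * t))) ∂ρ))) := by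
    have h0 := hν t
    simp only [NNReal.coe_zero, mul_zero, neg_zero, zero_sub] at h0
    rw [← h0]
    convert hg using 2 with n
    · exact (integral_map (hd.forall_aemeasurable n) g.continuous.aestronglyMeasurable).symm
    · simp [g]
  simpa using ((Real.continuousAt_log (Real.exp_pos _).ne').tendsto.comp hlim).neg

/-! ### The mass removed by pruning -/

theorem tendsto_prunedMass [IsProbabilityMeasure P]
    {X : (n : ℕ) → Fin n → Ω → ℝ≥0} (hX : ∀ n j, Measurable (X n j))
    (hind : ∀ n, iIndepFun (X n) P) {ρ : Measure ℝ≥0} (hconv : RowSumsTendstoID P X 0 ρ)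
    (hmean : MeanCondition P X 0 ρ) {κ : ℝ} (hκ : 0 < κ) :
    Tendsto (fun n => ∫⁻ ω, ∑ j, (if kappaThreshold κ (fun i => X n i ω) < X n j ω then 0
      else (X n j ω : ℝ≥0∞)) ∂P) atTop (𝓝 0) := by
  rw [ENNReal.tendsto_nhds_zero]
  intro δ hδ
  obtain ⟨δ', hδ', hδδ⟩ : ∃ δ' : ℝ≥0∞, 0 < δ' ∧ δ' + δ' ≤ δ :=
    ⟨δ / 2, ENNReal.half_pos hδ.ne', (ENNReal.add_halves δ).le⟩
  have hpsi := ENNReal.tendsto_ofReal (tendsto_laplaceExponent_div hmean.levy_mean_ne_top)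
  rw [ENNReal.ofReal_zero] at hpsi
  -- The level 1/t is fixed first, from the Laplace exponent alone; only then does the width grow.
  obtain ⟨t, htδ, ht⟩ := ((hpsi.eventually_lt_const hδ').and (eventually_gt_atTop 0)).exists
  have ht0 : (0 : ℝ≥0) < t := by exact_mod_cast ht
  have hsmall : ∀ᶠ n in atTop, ENNReal.ofReal (2 / ((t : ℝ≥0) : ℝ) *
      -Real.log (∫ ω, Real.exp (-(((t : ℝ≥0) : ℝ) * ((∑ j, X n j ω : ℝ≥0) : ℝ))) ∂P)) < δ' := by
    refine (ENNReal.tendsto_ofReal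
      ((hconv.tendsto_log_laplace (t : ℝ≥0)).const_mul (2 / ((t : ℝ≥0) : ℝ)))).eventually_lt_const ?_
    simpa using htδ
  set N : ℕ → ℝ≥0∞ := fun n => ∫⁻ ω, ∑ j, (X n j ω : ℝ≥0∞) ∂P with hN
  have hfloor : Tendsto (fun n : ℕ => ⌊κ * n⌋₊) atTop atTop :=
    tendsto_nat_floor_atTop.comp (tendsto_natCast_atTop_atTop.const_mul_atTop hκ)
  have hlarge : Tendsto (fun n : ℕ => N n ^ 2 / ((t⁻¹ : ℝ≥0) * ((⌊κ * n⌋₊ - 2 + 1 : ℕ) : ℝ≥0∞)))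
      atTop (𝓝 0) := by
    have h1 : Tendsto (fun n : ℕ => ((⌊κ * n⌋₊ - 2 + 1 : ℕ) : ℝ≥0∞)) atTop (𝓝 ∞) :=
      ENNReal.tendsto_nat_nhds_top.comp
        ((tendsto_add_atTop_nat 1).comp ((tendsto_sub_atTop_nat 2).comp hfloor))
    have h2 : Tendsto (fun n : ℕ => ((t⁻¹ : ℝ≥0) : ℝ≥0∞) * ((⌊κ * n⌋₊ - 2 + 1 : ℕ) : ℝ≥0∞))
        atTop (𝓝 ∞) := by
      have hne : ((t⁻¹ : ℝ≥0) : ℝ≥0∞) ≠ 0 := by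
        exact_mod_cast (inv_pos.2 ht0).ne'
      simpa [ENNReal.mul_top hne] using
        ENNReal.Tendsto.const_mul (a := ((t⁻¹ : ℝ≥0) : ℝ≥0∞)) h1 (Or.inl ENNReal.top_ne_zero)
    have h3 := ENNReal.Tendsto.pow (n := 2) hmean.tendsto_mean
    have := ENNReal.Tendsto.div h3 (Or.inr ENNReal.top_ne_zero) h2 (Or.inr ?_)
    · simpa using this
    · simpa using hmean.levy_mean_ne_top
  filter_upwards [hsmall, hlarge.eventually_lt_const hδ', hfloor.eventually_ge_atTop 2]
    with n hn1 hn2 hn3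
  -- Chosen so that the pruning rank is `m + 2`, as `lintegral_sum_large_le` requires.
  set m := ⌊κ * n⌋₊ - 2 with hm
  have hm2 : ⌊κ * n⌋₊ = m + 2 := by omega
  have hpt : ∀ ω j, (if kappaThreshold κ (fun i => X n i ω) < X n j ω then 0
      else (X n j ω : ℝ≥0∞)) ≤ (if (t : ℝ≥0) * X n j ω ≤ 1 then (X n j ω : ℝ≥0∞) else 0) +
        (if m + 2 ≤ (Finset.univ.filter fun i => (t⁻¹ : ℝ≥0) < X n i ω).card
          then (X n j ω : ℝ≥0∞) else 0) := by
    intro ω j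
    by_cases h1 : kappaThreshold κ (fun i => X n i ω) < X n j ω
    · simp [h1]
    rw [if_neg h1]
    by_cases h2 : (t : ℝ≥0) * X n j ω ≤ 1
    · simp [h2]
    -- A pruned entry is at most the threshold, so an entry above 1/t lifts the threshold above 1/t.
    · have h3 : (t⁻¹ : ℝ≥0) < kappaThreshold κ (fun i => X n i ω) := by
        refine lt_of_lt_of_le ?_ (not_lt.1 h1)
        rw [inv_lt_iff_one_lt_mul₀' ht0]
        exact not_le.1 h2
      have h4 := le_card_of_lt_orderStat (by omega) h3
      rw [hm2] at h4
      rw [if_pos h4]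
      exact le_add_self
  refine le_trans ?_ hδδ
  have hmeas : Measurable fun ω => ∑ j, (if (t : ℝ≥0) * X n j ω ≤ 1 then (X n j ω : ℝ≥0∞) else 0) :=
    Finset.measurable_fun_sum _ fun j _ =>
      Measurable.ite (measurableSet_le ((hX n j).const_mul _) measurable_const)
        (hX n j).coe_nnreal_ennreal measurable_const
  calc _ ≤ ∫⁻ ω, (∑ j, (if (t : ℝ≥0) * X n j ω ≤ 1 then (X n j ω : ℝ≥0∞) else 0) +
        ∑ j, (if m + 2 ≤ (Finset.univ.filter fun i => (t⁻¹ : ℝ≥0) < X n i ω).card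
          then (X n j ω : ℝ≥0∞) else 0)) ∂P := by
        refine lintegral_mono fun ω => ?_
        rw [← Finset.sum_add_distrib]
        exact Finset.sum_le_sum fun j _ => hpt ω j
    _ ≤ δ' + δ' := by
        rw [lintegral_add_left hmeas]
        exact add_le_add ((lintegral_sum_small_le (hX n) (hind n) ht0).trans hn1.le)
          ((lintegral_sum_large_le (hX n) (hind n) _ (inv_pos.2 ht0) m).trans hn2.le)

end Row

/-! ### Second moments of Gaussian sums -/

theorem lintegral_enorm_sq_eq_top_of_not_memLp {Ω : Type*} [MeasurableSpace Ω] {P : Measure Ω}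
    {c : Ω → ℝ} (hc : Measurable c) (h : ¬ MemLp c 2 P) : ∫⁻ ω, ‖c ω‖ₑ ^ 2 ∂P = ∞ := by
  by_contra hne
  refine h ⟨hc.aestronglyMeasurable, ?_⟩
  rw [eLpNorm_lt_top_iff_lintegral_rpow_enorm_lt_top (by norm_num) (by norm_num)]
  simpa [lt_top_iff_ne_top] using hne

/-- Orthogonality: the second moment of a sum of centred Gaussian variables, pairwise independent,
with coefficients that are independent of them. -/
theorem lintegral_enorm_sq_sum_mul_le {Ω : Type*} {m₁ m₂ : MeasurableSpace Ω}
    [mΩ : MeasurableSpace Ω] {P : Measure Ω} [IsProbabilityMeasure P] {n : ℕ} {σ : ℝ≥0} (hσ : 0 < σ)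
    (hm₂ : m₂ ≤ mΩ) (hind : Indep m₂ m₁ P) {c V : Fin n → Ω → ℝ}
    (hcm : ∀ j, Measurable[m₂] (c j)) (hVm : ∀ j, Measurable[m₁] (V j))
    (hV : ∀ j, HasLaw (V j) (gaussianReal 0 (σ ^ 2)) P)
    (hVi : Pairwise fun i j => IndepFun (V i) (V j) P) :
    ∫⁻ ω, ‖∑ j, c j ω * V j ω‖ₑ ^ 2 ∂P ≤ (σ : ℝ≥0∞) ^ 2 * ∑ j, ∫⁻ ω, ‖c j ω‖ₑ ^ 2 ∂P := by
  -- If some coefficient is not square integrable, the right side is infinite because `0 < σ`. No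
  -- integrability hypothesis is needed.
  by_cases hL : ∀ j, MemLp (c j) 2 P
  swap
  · push Not at hL
    obtain ⟨j, hj⟩ := hL
    have htop : ∑ j, ∫⁻ ω, ‖c j ω‖ₑ ^ 2 ∂P = ∞ := ENNReal.sum_eq_top.2
      ⟨j, Finset.mem_univ j, lintegral_enorm_sq_eq_top_of_not_memLp ((hcm j).mono hm₂ le_rfl) hj⟩
    rw [htop, ENNReal.mul_top (pow_ne_zero _ (by exact_mod_cast hσ.ne'))]
    exact le_top
  have hVL : ∀ j, MemLp (V j) 2 P := fun j => by
    have := memLp_id_gaussianReal (μ := 0) (v := σ ^ 2) 2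
    rw [← (hV j).map_eq] at this
    exact (memLp_map_measure_iff (by fun_prop) (hV j).aemeasurable).1 this
  have hV0 : ∀ j, ∫ ω, V j ω ∂P = 0 := fun j => by
    rw [(hV j).integral_eq, integral_id_gaussianReal]
  have hV2 : ∀ j, ∫ ω, V j ω * V j ω ∂P = (σ : ℝ) ^ 2 := fun j => by
    have h1 : Var[V j; P] = (σ : ℝ) ^ 2 := by
      rw [(hV j).variance_eq, variance_id_gaussianReal]
      simp
    rw [variance_of_integral_eq_zero (hV j).aemeasurable (hV0 j)] at h1
    simpa only [sq] using h1
  have hindf : ∀ i j, IndepFun (fun ω => c i ω * c j ω) (fun ω => V i ω * V j ω) P := fun i j => by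
    rw [IndepFun_iff_Indep]
    exact indep_of_indep_of_le hind ((hcm i).mul (hcm j)).comap_le ((hVm i).mul (hVm j)).comap_le
  have hcc : ∀ i j, Integrable (fun ω => c i ω * c j ω) P := fun i j =>
    (hL i).integrable_mul (hL j)
  have hVV : ∀ i j, Integrable (fun ω => V i ω * V j ω) P := fun i j =>
    (hVL i).integrable_mul (hVL j)
  have hprod : ∀ i j, Integrable (fun ω => (c i ω * c j ω) * (V i ω * V j ω)) P := fun i j =>
    (hindf i j).integrable_mul (hcc i j) (hVV i j)
  have hval : ∀ i j, ∫ ω, (c i ω * c j ω) * (V i ω * V j ω) ∂P =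
      if i = j then (σ : ℝ) ^ 2 * ∫ ω, c i ω * c i ω ∂P else 0 := fun i j => by
    have h1 : ∫ ω, (c i ω * c j ω) * (V i ω * V j ω) ∂P =
        (∫ ω, c i ω * c j ω ∂P) * ∫ ω, V i ω * V j ω ∂P :=
      (hindf i j).integral_mul_eq_mul_integral (hcc i j).aestronglyMeasurable
        (hVV i j).aestronglyMeasurable
    rw [h1]
    split_ifs with hij
    · subst hij
      rw [hV2, mul_comm]
    · have h2 : ∫ ω, V i ω * V j ω ∂P = (∫ ω, V i ω ∂P) * ∫ ω, V j ω ∂P :=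
        (hVi hij).integral_mul_eq_mul_integral (hVL i).aestronglyMeasurable
          (hVL j).aestronglyMeasurable
      rw [h2, hV0, zero_mul, mul_zero]
  have hexp : ∀ ω, (∑ j, c j ω * V j ω) ^ 2 = ∑ i, ∑ j, (c i ω * c j ω) * (V i ω * V j ω) :=
    fun ω => by
      rw [sq, Finset.sum_mul_sum]
      exact Finset.sum_congr rfl fun i _ => Finset.sum_congr rfl fun j _ => by ring
  have hlint : ∀ f : Ω → ℝ, Integrable (fun ω => f ω ^ 2) P →
      ∫⁻ ω, ‖f ω‖ₑ ^ 2 ∂P = ENNReal.ofReal (∫ ω, f ω ^ 2 ∂P) := fun f hf => by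
    rw [ofReal_integral_eq_lintegral_ofReal hf (ae_of_all _ fun ω => sq_nonneg _)]
    refine lintegral_congr fun ω => ?_
    rw [Real.enorm_eq_ofReal_abs, ← ENNReal.ofReal_pow (abs_nonneg _), sq_abs]
  rw [hlint _ (by
    simp_rw [hexp]
    exact integrable_finsetSum _ fun i _ => integrable_finsetSum _ fun j _ => hprod i j)]
  simp_rw [hexp]
  rw [integral_finsetSum _ fun i _ => integrable_finsetSum _ fun j _ => hprod i j]
  simp_rw [integral_finsetSum Finset.univ fun j (_ : j ∈ Finset.univ) => hprod _ j, hval]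
  simp only [Finset.sum_ite_eq, Finset.mem_univ, if_true]
  rw [← Finset.mul_sum, ENNReal.ofReal_mul (by positivity), ENNReal.ofReal_sum_of_nonneg
    fun i _ => integral_nonneg fun ω => mul_self_nonneg _, ENNReal.ofReal_pow σ.coe_nonneg,
    ENNReal.ofReal_coe_nnreal]
  gcongr with j
  rw [hlint _ (by simpa only [sq] using hcc j j)]
  simp only [sq, le_refl]

/-! ### Positive homogeneous activations -/

/-- Each half-line is governed by one value, φ(1) or φ(-1), and φ(0) = 2φ(0). Measurability and the
Lipschitz bound follow from this formula. -/
theorem PositiveHomogeneous.eq_max {φ : ℝ → ℝ} (hφ : PositiveHomogeneous φ) (x : ℝ) :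
    φ x = φ 1 * max x 0 + φ (-1) * max (-x) 0 := by
  have h0 : φ 0 = 0 := by
    have := hφ 2 two_pos 0
    rw [mul_zero] at this
    linarith
  rcases lt_trichotomy x 0 with h | rfl | h
  · have := hφ (-x) (neg_pos.2 h) (-1)
    rw [max_eq_right h.le, max_eq_left (neg_pos.2 h).le, mul_zero, zero_add, mul_comm, ← this]
    simp
  · simp [h0]
  · have := hφ x h 1
    rw [mul_one] at this
    rw [max_eq_left h.le, max_eq_right (neg_neg_of_pos h).le, mul_zero, add_zero, this, mul_comm]

theorem PositiveHomogeneous.map_zero {φ : ℝ → ℝ} (hφ : PositiveHomogeneous φ) : φ 0 = 0 := by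
  rw [hφ.eq_max]
  simp

theorem PositiveHomogeneous.measurable {φ : ℝ → ℝ} (hφ : PositiveHomogeneous φ) :
    Measurable φ := by
  rw [funext hφ.eq_max]
  fun_prop

theorem PositiveHomogeneous.exists_lipschitzWith {φ : ℝ → ℝ} (hφ : PositiveHomogeneous φ) :
    ∃ K : ℝ≥0, LipschitzWith K φ := by
  refine ⟨‖φ 1‖₊ + ‖φ (-1)‖₊, LipschitzWith.of_dist_le_mul fun x y => ?_⟩
  have h1 : |max x 0 - max y 0| ≤ |x - y| := by
    simpa using abs_max_sub_max_le_max x 0 y 0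
  have h2 : |max (-x) 0 - max (-y) 0| ≤ |x - y| := by
    have := abs_max_sub_max_le_max (-x) 0 (-y) 0
    rwa [sub_self, abs_zero, max_eq_left (abs_nonneg (-x - -y)), neg_sub_neg, abs_sub_comm y x] at this
  rw [Real.dist_eq, Real.dist_eq, hφ.eq_max x, hφ.eq_max y]
  calc |φ 1 * max x 0 + φ (-1) * max (-x) 0 - (φ 1 * max y 0 + φ (-1) * max (-y) 0)|
      = |φ 1 * (max x 0 - max y 0) + φ (-1) * (max (-x) 0 - max (-y) 0)| := by
        congr 1
        ring
    _ ≤ |φ 1| * |max x 0 - max y 0| + |φ (-1)| * |max (-x) 0 - max (-y) 0| := by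
        rw [← abs_mul, ← abs_mul]
        exact abs_add_le _ _
    _ ≤ |φ 1| * |x - y| + |φ (-1)| * |x - y| := by gcongr
    _ = _ := by
        push_cast
        rw [Real.norm_eq_abs, Real.norm_eq_abs, add_mul]

theorem enorm_sq_sub_le_of_lipschitzWith {φ : ℝ → ℝ} {K : ℝ≥0} (hK : LipschitzWith K φ) (x y : ℝ) :
    ‖φ x - φ y‖ₑ ^ 2 ≤ (K : ℝ≥0∞) ^ 2 * ‖x - y‖ₑ ^ 2 := by
  rw [← mul_pow, ← edist_eq_enorm_sub, ← edist_eq_enorm_sub]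
  gcongr
  exact hK x y

theorem enorm_add_sq_le (a b : ℝ) : ‖a + b‖ₑ ^ 2 ≤ 4 * (‖a‖ₑ ^ 2 + ‖b‖ₑ ^ 2) := by
  have h : ‖a‖ₑ + ‖b‖ₑ ≤ 2 * max ‖a‖ₑ ‖b‖ₑ := by
    rw [two_mul]
    exact add_le_add (le_max_left _ _) (le_max_right _ _)
  calc ‖a + b‖ₑ ^ 2 ≤ (2 * max ‖a‖ₑ ‖b‖ₑ) ^ 2 := by
        gcongr
        exact (enorm_add_le a b).trans h
    _ = 4 * max ‖a‖ₑ ‖b‖ₑ ^ 2 := by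
        rw [mul_pow]
        norm_num
    _ ≤ _ := by
        gcongr
        rcases max_choice ‖a‖ₑ ‖b‖ₑ with h | h <;> rw [h]
        exacts [le_self_add, le_add_self]

theorem enorm_sqrt_sq (u : ℝ≥0) : ‖Real.sqrt u‖ₑ ^ 2 = u := by
  rw [Real.enorm_of_nonneg (Real.sqrt_nonneg _), ← ENNReal.ofReal_pow (Real.sqrt_nonneg _),
    Real.sq_sqrt u.coe_nonneg, ENNReal.ofReal_coe_nnreal]

/-! ### The sigma-algebras generated by parts of the model -/

section Model

variable {Ω : Type*} {L din : ℕ}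

/-- The indices of the random variables of the networks with widths `p`. -/
abbrev ModelIndex (p : Fin L → ℕ) : Type :=
  (Σ l : Fin L, Fin (p l)) ⊕ ((Fin (L + 1) × ℕ × ℕ) ⊕ (Fin (L + 1) × ℕ))

/-- The random variables of the networks with widths `p`. -/
def modelVar (lam : (l : Fin L) → (n : ℕ) → Fin n → Ω → ℝ≥0)
    (V : Fin (L + 1) → ℕ → ℕ → Ω → ℝ) (B : Fin (L + 1) → ℕ → Ω → ℝ) (p : Fin L → ℕ) :
    ModelIndex p → Ω → ℝ :=
  Sum.elim (fun (i : Σ l : Fin L, Fin (p l)) (ω : Ω) => (lam i.1 (p i.1) i.2 ω : ℝ))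
    (Sum.elim (fun (i : Fin (L + 1) × ℕ × ℕ) => V i.1 i.2.1 i.2.2)
      (fun (i : Fin (L + 1) × ℕ) => B i.1 i.2))

/-- The sigma-algebra generated by the variables with indices in `S`. -/
@[reducible]
def generatedBy (lam : (l : Fin L) → (n : ℕ) → Fin n → Ω → ℝ≥0)
    (V : Fin (L + 1) → ℕ → ℕ → Ω → ℝ) (B : Fin (L + 1) → ℕ → Ω → ℝ) (p : Fin L → ℕ)
    (S : Set (ModelIndex p)) : MeasurableSpace Ω :=
  ⨆ i ∈ S, MeasurableSpace.comap (modelVar lam V B p i) inferInstance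

/-- The variables on which the pre-activations at `l` depend. -/
def historyIndices (p : Fin L → ℕ) (l : Fin (L + 1)) : Set (ModelIndex p) :=
  {i | Sum.elim (fun i : (Σ l : Fin L, Fin (p l)) => i.1.castSucc < l)
    (Sum.elim (fun i : Fin (L + 1) × ℕ × ℕ => i.1 ≤ l) (fun i : Fin (L + 1) × ℕ => i.1 ≤ l)) i}

/-- The node variances of hidden layer `l`. -/
def varianceIndices (p : Fin L → ℕ) (l : Fin L) : Set (ModelIndex p) :=
  {i | Sum.elim (fun i : (Σ l : Fin L, Fin (p l)) => i.1 = l) (fun _ => False) i}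

/-- The Gaussian factors of the weights into layer `l`. -/
def weightIndices (p : Fin L → ℕ) (l : Fin (L + 1)) : Set (ModelIndex p) :=
  {i | Sum.elim (fun _ => False)
    (Sum.elim (fun i : Fin (L + 1) × ℕ × ℕ => i.1 = l) (fun _ => False)) i}

/-- The variances of hidden layer `l` first enter the pre-activations at `l.succ`; hence the strict
inequality in `historyIndices`. -/
theorem disjoint_varianceIndices_historyIndices (p : Fin L → ℕ) (l : Fin L) :
    Disjoint (varianceIndices p l) (historyIndices p l.castSucc) := by
  rw [Set.disjoint_left]
  rintro (i | i | i) h1 h2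
  · have h3 : i.1.castSucc < l.castSucc := h2
    rw [show i.1 = l from h1] at h3
    exact lt_irrefl _ h3
  · exact h1
  · exact h1

theorem disjoint_historyIndices_union_weightIndices (p : Fin L → ℕ) (l : Fin L) :
    Disjoint (historyIndices p l.castSucc ∪ varianceIndices p l) (weightIndices p l.succ) := by
  rw [Set.disjoint_right]
  rintro (i | i | i) h1 h2
  · exact h1
  · rcases h2 with h2 | h2
    · have h3 : i.1 ≤ l.castSucc := h2
      rw [show i.1 = l.succ from h1] at h3
      exact absurd h3 (not_le.2 Fin.castSucc_lt_succ)
    · exact h2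
  · exact h1

variable {lam : (l : Fin L) → (n : ℕ) → Fin n → Ω → ℝ≥0}
  {V : Fin (L + 1) → ℕ → ℕ → Ω → ℝ} {B : Fin (L + 1) → ℕ → Ω → ℝ} {p : Fin L → ℕ}

theorem measurable_modelVar_generatedBy {S : Set (ModelIndex p)} {i : ModelIndex p} (hi : i ∈ S) :
    Measurable[generatedBy lam V B p S] (modelVar lam V B p i) :=
  Measurable.mono (comap_measurable _) (le_iSup₂ (f := fun i (_ : i ∈ S) =>
    MeasurableSpace.comap (modelVar lam V B p i) inferInstance) i hi) le_rfl

theorem generatedBy_mono {S T : Set (ModelIndex p)} (h : S ⊆ T) :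
    generatedBy lam V B p S ≤ generatedBy lam V B p T :=
  biSup_mono h

theorem measurable_lam_generatedBy {S : Set (ModelIndex p)} {l : Fin L} {j : Fin (p l)}
    (hi : Sum.inl ⟨l, j⟩ ∈ S) : Measurable[generatedBy lam V B p S] (lam l (p l) j) := by
  have := measurable_real_toNNReal.comp (measurable_modelVar_generatedBy (lam := lam) (V := V)
    (B := B) hi)
  convert this using 1
  ext ω
  simp [modelVar]

theorem measurable_V_generatedBy {S : Set (ModelIndex p)} {l : Fin (L + 1)} {j k : ℕ}
    (hi : Sum.inr (Sum.inl (l, j, k)) ∈ S) : Measurable[generatedBy lam V B p S] (V l j k) :=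
  measurable_modelVar_generatedBy hi

theorem measurable_B_generatedBy {S : Set (ModelIndex p)} {l : Fin (L + 1)} {k : ℕ}
    (hi : Sum.inr (Sum.inr (l, k)) ∈ S) : Measurable[generatedBy lam V B p S] (B l k) :=
  measurable_modelVar_generatedBy hi

/-! ### Networks with random gates -/

/-- The network in which the weight out of node `j` of hidden layer `l` is `g l j` times its
Gaussian factor. -/
noncomputable def gatedNetwork (φ : ℝ → ℝ) (V : Fin (L + 1) → ℕ → ℕ → Ω → ℝ) (B : Fin (L + 1) → ℕ → Ω → ℝ)
    (x : Fin din → ℝ) (p : Fin L → ℕ) (g : (l : Fin L) → Fin (p l) → Ω → ℝ) (ω : Ω) :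
    Fin (L + 1) → ℕ → ℝ :=
  preactivation φ p (fun j k => Real.sqrt (1 / (din : ℝ)) * V 0 j k ω)
    (fun l j k => g l j ω * V l.succ j k ω) (fun l k => B l k ω) x

variable {φ : ℝ → ℝ} {x : Fin din → ℝ} {g : (l : Fin L) → Fin (p l) → Ω → ℝ}

theorem gatedNetwork_zero (ω : Ω) (k : ℕ) :
    gatedNetwork φ V B x p g ω 0 k =
      ∑ j : Fin din, Real.sqrt (1 / (din : ℝ)) * x j * V 0 j k ω + B 0 k ω := by
  simp only [gatedNetwork, preactivation, Fin.induction_zero]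
  congr 1
  exact Finset.sum_congr rfl fun j _ => by ring

theorem gatedNetwork_succ (ω : Ω) (l : Fin L) (k : ℕ) :
    gatedNetwork φ V B x p g ω l.succ k =
      ∑ j : Fin (p l), g l j ω * φ (gatedNetwork φ V B x p g ω l.castSucc j) * V l.succ j k ω +
        B l.succ k ω := by
  simp only [gatedNetwork, preactivation, Fin.induction_succ]
  congr 1
  exact Finset.sum_congr rfl fun j _ => by ring

theorem measurable_affine {Ω : Type*} [MeasurableSpace Ω] {n : ℕ} {c v : Fin n → Ω → ℝ} {b : Ω → ℝ}
    (hc : ∀ j, Measurable (c j)) (hv : ∀ j, Measurable (v j)) (hb : Measurable b) :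
    Measurable fun ω => ∑ j, c j ω * v j ω + b ω :=
  (Finset.measurable_fun_sum _ fun j _ => (hc j).mul (hv j)).add hb

/-- A gate may depend on the whole row of variances of its layer, as the pruning threshold does; the
pruned and unpruned networks are thus treated together. -/
theorem measurable_gatedNetwork (hφ : Measurable φ)
    (hg : ∀ l j, Measurable[generatedBy lam V B p (varianceIndices p l)] (g l j))
    (l : Fin (L + 1)) (k : ℕ) :
    Measurable[generatedBy lam V B p (historyIndices p l)]
      fun ω => gatedNetwork φ V B x p g ω l k := by
  induction l using Fin.induction generalizing k with
  | zero =>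
    simp_rw [gatedNetwork_zero]
    refine @measurable_affine Ω (generatedBy lam V B p _) din _ _ _ (fun j => measurable_const)
      (fun j => measurable_V_generatedBy ?_) (measurable_B_generatedBy ?_)
    exacts [le_refl (0 : Fin (L + 1)), le_refl (0 : Fin (L + 1))]
  | succ l ih =>
    simp_rw [gatedNetwork_succ]
    refine @measurable_affine Ω (generatedBy lam V B p _) (p l) _ _ _ (fun j => ?_)
      (fun j => measurable_V_generatedBy ?_) (measurable_B_generatedBy ?_)
    · refine Measurable.mul ((hg l j).mono (generatedBy_mono ?_) le_rfl)
        (hφ.comp ((ih j).mono (generatedBy_mono ?_) le_rfl))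
      · rintro (i | i | i) hi
        · change i.1.castSucc < l.succ
          rw [show i.1 = l from hi]
          exact Fin.castSucc_lt_succ
        · exact hi.elim
        · exact hi.elim
      · rintro (i | i | i) hi
        · exact lt_trans (show i.1.castSucc < l.castSucc from hi) Fin.castSucc_lt_succ
        · exact le_trans (show i.1 ≤ l.castSucc from hi) Fin.castSucc_lt_succ.le
        · exact le_trans (show i.1 ≤ l.castSucc from hi) Fin.castSucc_lt_succ.le
    exacts [le_refl l.succ, le_refl l.succ]

/-! ### Independence in the model -/

variable [mΩ : MeasurableSpace Ω] {P : Measure Ω} {σb σv : ℝ≥0} {μ : Fin L → ℕ → Measure ℝ≥0}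

theorem IsModel.measurable_modelVar (h : IsModel P σb σv μ lam V B) (i : ModelIndex p) :
    Measurable (modelVar lam V B p i) := by
  rcases i with i | i | i
  · exact (h.measurable_lam _ _ _).coe_nnreal_real
  · exact h.measurable_V _ _ _
  · exact h.measurable_B _ _

theorem IsModel.generatedBy_le (h : IsModel P σb σv μ lam V B) (S : Set (ModelIndex p)) :
    generatedBy lam V B p S ≤ mΩ :=
  iSup₂_le fun i _ => (h.measurable_modelVar i).comap_le

theorem IsModel.indep_generatedBy (h : IsModel P σb σv μ lam V B) {S T : Set (ModelIndex p)}
    (hST : Disjoint S T) : Indep (generatedBy lam V B p S) (generatedBy lam V B p T) P :=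
  indep_iSup_of_disjoint (fun i => (h.measurable_modelVar i).comap_le) (h.indep p).iIndep hST

theorem IsModel.iIndepFun_lam (h : IsModel P σb σv μ lam V B) (l : Fin L) (n : ℕ) :
    iIndepFun (lam l n) P := by
  -- Independence is given per width vector; constant width `n` contains the row.
  have h1 := (h.indep fun _ => n).precomp (g := fun j : Fin n => Sum.inl ⟨l, j⟩)
    fun i j hij => by simpa using hij
  have h2 := h1.comp (fun _ => Real.toNNReal) fun _ => measurable_real_toNNReal
  convert h2 using 1
  ext j ω
  simp

theorem IsModel.pairwise_indepFun_V (h : IsModel P σb σv μ lam V B) (l : Fin (L + 1)) (k n : ℕ) :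
    Pairwise fun i j : Fin n => IndepFun (V l i k) (V l j k) P := fun i j hij =>
  (h.indep fun _ => 0).indepFun (i := Sum.inr (Sum.inl (l, (i : ℕ), k)))
    (j := Sum.inr (Sum.inl (l, (j : ℕ), k))) (by simpa [Fin.ext_iff] using hij)

/-- The common second moment of the biases. -/
noncomputable def biasMoment (σb : ℝ≥0) : ℝ≥0∞ := ∫⁻ b, ‖b‖ₑ ^ 2 ∂gaussianReal 0 (σb ^ 2)

theorem biasMoment_ne_top (σb : ℝ≥0) : biasMoment σb ≠ ∞ := by
  have := (memLp_id_gaussianReal (μ := 0) (v := σb ^ 2) 2).2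
  rw [eLpNorm_lt_top_iff_lintegral_rpow_enorm_lt_top (by norm_num) (by norm_num)] at this
  simpa [biasMoment] using this.ne

theorem IsModel.lintegral_B (h : IsModel P σb σv μ lam V B) (l : Fin (L + 1)) (k : ℕ) :
    ∫⁻ ω, ‖B l k ω‖ₑ ^ 2 ∂P = biasMoment σb := by
  rw [biasMoment, ← (h.law_B l k).map_eq, lintegral_map (by fun_prop) (h.measurable_B l k)]

theorem IsModel.lintegral_mul (h : IsModel P σb σv μ lam V B) (l : Fin L) {f f' : Ω → ℝ≥0∞}
    (hf : Measurable[generatedBy lam V B p (varianceIndices p l)] f)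
    (hf' : Measurable[generatedBy lam V B p (historyIndices p l.castSucc)] f') :
    ∫⁻ ω, f ω * f' ω ∂P = (∫⁻ ω, f ω ∂P) * ∫⁻ ω, f' ω ∂P :=
  lintegral_mul_eq_lintegral_mul_lintegral_of_independent_measurableSpace (h.generatedBy_le _)
    (h.generatedBy_le _) (h.indep_generatedBy (disjoint_varianceIndices_historyIndices p l)) hf hf'

theorem IsModel.lintegral_layer_le [IsProbabilityMeasure P] (h : IsModel P σb σv μ lam V B)
    (hσv : 0 < σv) (l : Fin L) (k : ℕ) {c : Fin (p l) → Ω → ℝ}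
    (hc : ∀ j, Measurable[generatedBy lam V B p
      (historyIndices p l.castSucc ∪ varianceIndices p l)] (c j)) :
    ∫⁻ ω, ‖∑ j, c j ω * V l.succ j k ω‖ₑ ^ 2 ∂P ≤
      (σv : ℝ≥0∞) ^ 2 * ∑ j, ∫⁻ ω, ‖c j ω‖ₑ ^ 2 ∂P :=
  lintegral_enorm_sq_sum_mul_le hσv (h.generatedBy_le _)
    (h.indep_generatedBy (disjoint_historyIndices_union_weightIndices p l)) hc
    (fun _ => measurable_V_generatedBy (show l.succ = l.succ from rfl)) (fun _ => h.law_V _ _ _)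
    (h.pairwise_indepFun_V _ _ _)

end Model

/-! ### Gates and variances under pruning -/

/-- The part of a node variance that `κ`-pruning removes. -/
noncomputable def prunedPart (κ : ℝ) {n : ℕ} (v : Fin n → ℝ≥0) (j : Fin n) : ℝ≥0∞ :=
  if kappaThreshold κ v < v j then 0 else v j

theorem measurable_prunedPart (κ : ℝ) {n : ℕ} (j : Fin n) :
    Measurable fun v : Fin n → ℝ≥0 => prunedPart κ v j :=
  Measurable.ite (measurableSet_lt (measurable_kappaThreshold κ n) (measurable_pi_apply j))
    measurable_const (measurable_pi_apply j).coe_nnreal_ennreal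

/-- The square root of a node variance, replaced by zero if `κ`-pruning removes the node. -/
noncomputable def prunedGate (κ : ℝ) {n : ℕ} (v : Fin n → ℝ≥0) (j : Fin n) : ℝ :=
  if kappaThreshold κ v < v j then Real.sqrt (v j) else 0

theorem measurable_prunedGate (κ : ℝ) {n : ℕ} (j : Fin n) :
    Measurable fun v : Fin n → ℝ≥0 => prunedGate κ v j :=
  Measurable.ite (measurableSet_lt (measurable_kappaThreshold κ n) (measurable_pi_apply j))
    (measurable_pi_apply j).coe_nnreal_real.sqrt measurable_const

/-- A kept node has the same gate in both networks and contributes only the first term; a pruned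
node contributes only the second, which involves the unpruned state alone. -/
theorem enorm_sq_gate_sub_le (κ : ℝ) {n : ℕ} (v : Fin n → ℝ≥0) (j : Fin n) (y z : ℝ) :
    ‖Real.sqrt (v j) * y - prunedGate κ v j * z‖ₑ ^ 2 ≤
      v j * ‖y - z‖ₑ ^ 2 + prunedPart κ v j * ‖y‖ₑ ^ 2 := by
  unfold prunedGate prunedPart
  split_ifs
  · rw [← mul_sub, enorm_mul, mul_pow, enorm_sqrt_sq]
    exact le_self_add
  · rw [zero_mul, sub_zero, enorm_mul, mul_pow, enorm_sqrt_sq]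
    exact le_add_self

theorem measurable_enorm_sq {Ω : Type*} {m : MeasurableSpace Ω} {f : Ω → ℝ} (hf : Measurable f) :
    Measurable fun ω => ‖f ω‖ₑ ^ 2 :=
  hf.enorm.pow_const 2

/-! ### Recursions over the layers -/

section Model

variable {Ω : Type*} {L din : ℕ} {lam : (l : Fin L) → (n : ℕ) → Fin n → Ω → ℝ≥0}
  {V : Fin (L + 1) → ℕ → ℕ → Ω → ℝ} {B : Fin (L + 1) → ℕ → Ω → ℝ} {p : Fin L → ℕ}
  {φ : ℝ → ℝ} {x : Fin din → ℝ} {κ : ℝ}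

theorem measurable_lam_varianceIndices (l : Fin L) (j : Fin (p l)) :
    Measurable[generatedBy lam V B p (varianceIndices p l)] (lam l (p l) j) :=
  measurable_lam_generatedBy (show l = l from rfl)

theorem measurable_row_varianceIndices (l : Fin L) :
    Measurable[generatedBy lam V B p (varianceIndices p l)] fun ω i => lam l (p l) i ω := by
  refine @measurable_pi_lambda _ _ _ (generatedBy lam V B p _) _ _ fun i => ?_
  exact measurable_lam_varianceIndices l i

theorem measurable_sqrt_varianceIndices (l : Fin L) (j : Fin (p l)) :
    Measurable[generatedBy lam V B p (varianceIndices p l)]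
      fun ω => Real.sqrt (lam l (p l) j ω) :=
  (measurable_lam_varianceIndices l j).coe_nnreal_real.sqrt

theorem measurable_prunedGate_varianceIndices (l : Fin L) (j : Fin (p l)) :
    Measurable[generatedBy lam V B p (varianceIndices p l)]
      fun ω => prunedGate κ (fun i => lam l (p l) i ω) j :=
  (measurable_prunedGate κ j).comp (measurable_row_varianceIndices l)

theorem unpruned_eq_gatedNetwork (ω : Ω) : unpruned φ lam V B x p ω =
    gatedNetwork φ V B x p (fun l j ω => Real.sqrt (lam l (p l) j ω)) ω := rfl

theorem kappaPruned_eq_gatedNetwork (ω : Ω) : kappaPruned φ lam V B x p κ ω =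
    gatedNetwork φ V B x p (fun l j ω => prunedGate κ (fun i => lam l (p l) i ω) j) ω := rfl

theorem measurable_unpruned (hφ : Measurable φ) (l : Fin (L + 1)) (k : ℕ) :
    Measurable[generatedBy lam V B p (historyIndices p l)]
      fun ω => unpruned φ lam V B x p ω l k :=
  measurable_gatedNetwork hφ measurable_sqrt_varianceIndices l k

theorem measurable_kappaPruned (hφ : Measurable φ) (l : Fin (L + 1)) (k : ℕ) :
    Measurable[generatedBy lam V B p (historyIndices p l)]
      fun ω => kappaPruned φ lam V B x p κ ω l k :=
  measurable_gatedNetwork hφ measurable_prunedGate_varianceIndices l k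

variable [mΩ : MeasurableSpace Ω] {P : Measure Ω} {σb σv : ℝ≥0} {μ : Fin L → ℕ → Measure ℝ≥0}

/-- The largest second moment of the unpruned pre-activations at `l`. -/
noncomputable def maxMoment (P : Measure Ω) (φ : ℝ → ℝ)
    (lam : (l : Fin L) → (n : ℕ) → Fin n → Ω → ℝ≥0)
    (V : Fin (L + 1) → ℕ → ℕ → Ω → ℝ) (B : Fin (L + 1) → ℕ → Ω → ℝ)
    (x : Fin din → ℝ) (p : Fin L → ℕ) (l : Fin (L + 1)) : ℝ≥0∞ :=
  ⨆ k : ℕ, ∫⁻ ω, ‖unpruned φ lam V B x p ω l k‖ₑ ^ 2 ∂P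

/-- The largest second moment of the pruning errors at `l`. -/
noncomputable def maxError (P : Measure Ω) (φ : ℝ → ℝ)
    (lam : (l : Fin L) → (n : ℕ) → Fin n → Ω → ℝ≥0)
    (V : Fin (L + 1) → ℕ → ℕ → Ω → ℝ) (B : Fin (L + 1) → ℕ → Ω → ℝ)
    (x : Fin din → ℝ) (p : Fin L → ℕ) (κ : ℝ) (l : Fin (L + 1)) : ℝ≥0∞ :=
  ⨆ k : ℕ, ∫⁻ ω, ‖unpruned φ lam V B x p ω l k - kappaPruned φ lam V B x p κ ω l k‖ₑ ^ 2 ∂P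

theorem IsModel.lintegral_affine_le (h : IsModel P σb σv μ lam V B) (l : Fin (L + 1)) (k : ℕ)
    {f : Ω → ℝ} {M : ℝ≥0∞} (hM : ∫⁻ ω, ‖f ω‖ₑ ^ 2 ∂P ≤ M) :
    ∫⁻ ω, ‖f ω + B l k ω‖ₑ ^ 2 ∂P ≤ 4 * (M + biasMoment σb) :=
  calc ∫⁻ ω, ‖f ω + B l k ω‖ₑ ^ 2 ∂P
      ≤ ∫⁻ ω, 4 * (‖f ω‖ₑ ^ 2 + ‖B l k ω‖ₑ ^ 2) ∂P := lintegral_mono fun ω => enorm_add_sq_le _ _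
    _ = 4 * (∫⁻ ω, ‖f ω‖ₑ ^ 2 ∂P + biasMoment σb) := by
      rw [lintegral_const_mul' _ _ (by norm_num), lintegral_add_right _
        ((h.measurable_B l k).enorm.pow_const 2), h.lintegral_B]
    _ ≤ _ := by gcongr

theorem IsModel.maxMoment_zero_le [IsProbabilityMeasure P] (h : IsModel P σb σv μ lam V B)
    (hσv : 0 < σv) : maxMoment P φ lam V B x p 0 ≤
      4 * ((σv : ℝ≥0∞) ^ 2 * ∑ j, ‖Real.sqrt (1 / (din : ℝ)) * x j‖ₑ ^ 2 + biasMoment σb) := by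
  refine iSup_le fun k => ?_
  simp_rw [unpruned_eq_gatedNetwork, gatedNetwork_zero]
  refine h.lintegral_affine_le 0 k ?_
  -- The inputs are deterministic, so the coefficients are measurable for the trivial sigma-algebra,
  -- which is independent of everything.
  have := lintegral_enorm_sq_sum_mul_le (P := P) (m₁ := mΩ) (m₂ := ⊥) (n := din) hσv bot_le
    (indep_bot_left _) (c := fun j _ => Real.sqrt (1 / (din : ℝ)) * x j)
    (V := fun j => V 0 j k) (fun _ => measurable_const) (fun j => h.measurable_V _ _ _)
    (fun _ => h.law_V _ _ _) (h.pairwise_indepFun_V _ _ _)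
  simpa using this

theorem maxError_zero : maxError P φ lam V B x p κ 0 = 0 := by
  simp [maxError, unpruned_eq_gatedNetwork, kappaPruned_eq_gatedNetwork, gatedNetwork_zero]

theorem IsModel.maxMoment_succ_le [IsProbabilityMeasure P] (h : IsModel P σb σv μ lam V B)
    (hσv : 0 < σv) (hφ : PositiveHomogeneous φ) {K : ℝ≥0} (hK : LipschitzWith K φ) (l : Fin L) :
    maxMoment P φ lam V B x p l.succ ≤
      4 * ((σv : ℝ≥0∞) ^ 2 * ((K : ℝ≥0∞) ^ 2 * ((∫⁻ ω, ∑ j, (lam l (p l) j ω : ℝ≥0∞) ∂P) *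
        maxMoment P φ lam V B x p l.castSucc)) + biasMoment σb) := by
  refine iSup_le fun k => ?_
  simp_rw [unpruned_eq_gatedNetwork, gatedNetwork_succ, ← unpruned_eq_gatedNetwork]
  refine h.lintegral_affine_le l.succ k ((h.lintegral_layer_le hσv l k (c := fun j ω =>
    Real.sqrt (lam l (p l) j ω) * φ (unpruned φ lam V B x p ω l.castSucc j)) fun j => ?_).trans ?_)
  · exact ((measurable_sqrt_varianceIndices l j).mono
      (generatedBy_mono Set.subset_union_right) le_rfl).mul
      (hφ.measurable.comp ((measurable_unpruned hφ.measurable _ _).mono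
        (generatedBy_mono Set.subset_union_left) le_rfl))
  · gcongr
    rw [lintegral_finsetSum _ fun j _ => (h.measurable_lam _ _ _).coe_nnreal_ennreal,
      Finset.sum_mul, Finset.mul_sum]
    refine Finset.sum_le_sum fun j _ => ?_
    calc ∫⁻ ω, ‖Real.sqrt (lam l (p l) j ω) * φ (unpruned φ lam V B x p ω l.castSucc j)‖ₑ ^ 2 ∂P
        ≤ ∫⁻ ω, (K : ℝ≥0∞) ^ 2 *
            (lam l (p l) j ω * ‖unpruned φ lam V B x p ω l.castSucc j‖ₑ ^ 2) ∂P := by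
          refine lintegral_mono fun ω => ?_
          rw [enorm_mul, mul_pow, enorm_sqrt_sq, mul_left_comm]
          gcongr
          simpa [hφ.map_zero] using
            enorm_sq_sub_le_of_lipschitzWith hK (unpruned φ lam V B x p ω l.castSucc j) 0
      _ = (K : ℝ≥0∞) ^ 2 * ((∫⁻ ω, lam l (p l) j ω ∂P) *
            ∫⁻ ω, ‖unpruned φ lam V B x p ω l.castSucc j‖ₑ ^ 2 ∂P) := by
          rw [lintegral_const_mul' _ _ (by simp), h.lintegral_mul l
            (measurable_lam_varianceIndices l j).coe_nnreal_ennreal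
            (measurable_enorm_sq (measurable_unpruned hφ.measurable _ _))]
      _ ≤ _ := by
          gcongr
          exact le_iSup (fun k : ℕ => ∫⁻ ω, ‖unpruned φ lam V B x p ω l.castSucc k‖ₑ ^ 2 ∂P) j

/-- The biases cancel in the difference, so no additive constant survives, unlike in
`IsModel.maxMoment_succ_le`. Taking suprema over nodes lets the moments leave the sum over `j`,
which becomes the mean row sum or the mean pruned mass. -/
theorem IsModel.maxError_succ_le [IsProbabilityMeasure P] (h : IsModel P σb σv μ lam V B)
    (hσv : 0 < σv) (hφ : PositiveHomogeneous φ) {K : ℝ≥0} (hK : LipschitzWith K φ) (l : Fin L) :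
    maxError P φ lam V B x p κ l.succ ≤
      (σv : ℝ≥0∞) ^ 2 * ((K : ℝ≥0∞) ^ 2 *
        ((∫⁻ ω, ∑ j, (lam l (p l) j ω : ℝ≥0∞) ∂P) * maxError P φ lam V B x p κ l.castSucc +
        (∫⁻ ω, ∑ j, prunedPart κ (fun i => lam l (p l) i ω) j ∂P) *
          maxMoment P φ lam V B x p l.castSucc)) := by
  refine iSup_le fun k => ?_
  have hprun : ∀ j, Measurable[generatedBy lam V B p (varianceIndices p l)] fun ω =>
      prunedPart κ (fun i => lam l (p l) i ω) j := fun j =>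
    (measurable_prunedPart κ j).comp (measurable_row_varianceIndices l)
  have hZ := measurable_unpruned (lam := lam) (V := V) (B := B) (x := x) (p := p) hφ.measurable
    l.castSucc
  have hZ' := measurable_kappaPruned (lam := lam) (V := V) (B := B) (x := x) (p := p) (κ := κ)
    hφ.measurable l.castSucc
  have hsub : ∀ ω, unpruned φ lam V B x p ω l.succ k - kappaPruned φ lam V B x p κ ω l.succ k =
      ∑ j : Fin (p l), (Real.sqrt (lam l (p l) j ω) * φ (unpruned φ lam V B x p ω l.castSucc j) -
        prunedGate κ (fun i => lam l (p l) i ω) j *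
          φ (kappaPruned φ lam V B x p κ ω l.castSucc j)) * V l.succ j k ω := fun ω => by
    rw [unpruned_eq_gatedNetwork, kappaPruned_eq_gatedNetwork, gatedNetwork_succ,
      gatedNetwork_succ, add_sub_add_right_eq_sub, ← Finset.sum_sub_distrib]
    exact Finset.sum_congr rfl fun j _ => (sub_mul _ _ _).symm
  simp_rw [hsub]
  refine (h.lintegral_layer_le hσv l k (c := fun j ω =>
    Real.sqrt (lam l (p l) j ω) * φ (unpruned φ lam V B x p ω l.castSucc j) -
      prunedGate κ (fun i => lam l (p l) i ω) j *
        φ (kappaPruned φ lam V B x p κ ω l.castSucc j)) fun j => ?_).trans ?_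
  · exact (((measurable_sqrt_varianceIndices l j).mono
      (generatedBy_mono Set.subset_union_right) le_rfl).mul
      (hφ.measurable.comp ((hZ j).mono (generatedBy_mono Set.subset_union_left) le_rfl))).sub
      (((measurable_prunedGate_varianceIndices l j).mono
      (generatedBy_mono Set.subset_union_right) le_rfl).mul
      (hφ.measurable.comp ((hZ' j).mono (generatedBy_mono Set.subset_union_left) le_rfl)))
  · gcongr
    rw [lintegral_finsetSum _ fun j _ => (h.measurable_lam _ _ _).coe_nnreal_ennreal,
      lintegral_finsetSum _ fun j _ => (hprun j).mono (h.generatedBy_le _) le_rfl,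
      Finset.sum_mul, Finset.sum_mul, ← Finset.sum_add_distrib, Finset.mul_sum]
    refine Finset.sum_le_sum fun j _ => ?_
    have hD : Measurable[generatedBy lam V B p (historyIndices p l.castSucc)] fun ω =>
        ‖unpruned φ lam V B x p ω l.castSucc j - kappaPruned φ lam V B x p κ ω l.castSucc j‖ₑ ^ 2 :=
      measurable_enorm_sq ((hZ j).sub (hZ' j))
    have hl := (measurable_lam_varianceIndices (lam := lam) (V := V) (B := B) l j).coe_nnreal_ennreal
    calc _ ≤ ∫⁻ ω, (K : ℝ≥0∞) ^ 2 * (lam l (p l) j ω *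
            ‖unpruned φ lam V B x p ω l.castSucc j -
              kappaPruned φ lam V B x p κ ω l.castSucc j‖ₑ ^ 2 +
            prunedPart κ (fun i => lam l (p l) i ω) j *
              ‖unpruned φ lam V B x p ω l.castSucc j‖ₑ ^ 2) ∂P := by
          refine lintegral_mono fun ω =>
            (enorm_sq_gate_sub_le κ (fun i => lam l (p l) i ω) j _ _).trans ?_
          rw [mul_add, mul_left_comm, mul_left_comm ((K : ℝ≥0∞) ^ 2) (prunedPart _ _ _)]
          gcongr
          · exact enorm_sq_sub_le_of_lipschitzWith hK _ _
          · simpa [hφ.map_zero] using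
              enorm_sq_sub_le_of_lipschitzWith hK (unpruned φ lam V B x p ω l.castSucc j) 0
      _ = (K : ℝ≥0∞) ^ 2 * ((∫⁻ ω, lam l (p l) j ω ∂P) *
            ∫⁻ ω, ‖unpruned φ lam V B x p ω l.castSucc j -
              kappaPruned φ lam V B x p κ ω l.castSucc j‖ₑ ^ 2 ∂P +
            (∫⁻ ω, prunedPart κ (fun i => lam l (p l) i ω) j ∂P) *
              ∫⁻ ω, ‖unpruned φ lam V B x p ω l.castSucc j‖ₑ ^ 2 ∂P) := by
          rw [lintegral_const_mul' _ _ (by simp), lintegral_add_left, h.lintegral_mul l hl hD,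
            h.lintegral_mul l (hprun j) (measurable_enorm_sq (hZ j))]
          exact (hl.mono (h.generatedBy_le _) le_rfl).mul (hD.mono (h.generatedBy_le _) le_rfl)
      _ ≤ _ := by
          gcongr
          · exact le_iSup (fun k : ℕ => ∫⁻ ω, ‖unpruned φ lam V B x p ω l.castSucc k -
              kappaPruned φ lam V B x p κ ω l.castSucc k‖ₑ ^ 2 ∂P) j
          · exact le_iSup (fun k : ℕ => ∫⁻ ω, ‖unpruned φ lam V B x p ω l.castSucc k‖ₑ ^ 2 ∂P) j

/-! ### Passage to large widths -/

theorem tendsto_eval_pi_atTop {ι : Type*} (i : ι) :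
    Tendsto (fun p : ι → ℕ => p i) atTop atTop :=
  tendsto_atTop_atTop.2 fun b => ⟨fun _ => b, fun _ hp => hp i⟩

theorem MeanCondition.eventually_le {X : (n : ℕ) → Fin n → Ω → ℝ≥0} {ρ : Measure ℝ≥0}
    (h : MeanCondition P X 0 ρ) :
    ∃ N : ℝ≥0, ∀ᶠ n in atTop, ∫⁻ ω, ∑ j, (X n j ω : ℝ≥0∞) ∂P ≤ N := by
  have hlt : ((0 : ℝ≥0) : ℝ≥0∞) + ∫⁻ u, (u : ℝ≥0∞) ∂ρ < ∞ := by
    simpa [lt_top_iff_ne_top] using h.levy_mean_ne_top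
  obtain ⟨N, hN, -⟩ := ENNReal.lt_iff_exists_nnreal_btwn.1 hlt
  exact ⟨N, (h.tendsto_mean.eventually_lt_const hN).mono fun _ => le_of_lt⟩

theorem IsModel.eventually_maxMoment_le [IsProbabilityMeasure P] (h : IsModel P σb σv μ lam V B)
    (hσv : 0 < σv) (hφ : PositiveHomogeneous φ) {ρ : Fin L → Measure ℝ≥0}
    (hmean : ∀ l, MeanCondition P (lam l) 0 (ρ l)) (l : Fin (L + 1)) :
    ∃ M : ℝ≥0∞, M ≠ ∞ ∧ ∀ᶠ p : Fin L → ℕ in atTop, maxMoment P φ lam V B x p l ≤ M := by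
  obtain ⟨K, hK⟩ := hφ.exists_lipschitzWith
  induction l using Fin.induction with
  | zero =>
    refine ⟨_, ?_, Eventually.of_forall fun p => h.maxMoment_zero_le hσv⟩
    have h1 := biasMoment_ne_top σb
    have h2 : ∑ j, ‖Real.sqrt (1 / (din : ℝ)) * x j‖ₑ ^ 2 ≠ ∞ :=
      ENNReal.sum_ne_top.2 fun j _ => by finiteness
    finiteness
  | succ l ih =>
    obtain ⟨M, hM, hle⟩ := ih
    obtain ⟨N, hN⟩ := (hmean l).eventually_le
    refine ⟨4 * ((σv : ℝ≥0∞) ^ 2 * ((K : ℝ≥0∞) ^ 2 * (N * M)) + biasMoment σb), ?_, ?_⟩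
    · have := biasMoment_ne_top σb
      finiteness
    · filter_upwards [hle, (tendsto_eval_pi_atTop l).eventually hN] with p h1 h2
      refine (h.maxMoment_succ_le hσv hφ hK l).trans ?_
      gcongr

theorem IsModel.tendsto_maxError [IsProbabilityMeasure P] (h : IsModel P σb σv μ lam V B)
    (hσv : 0 < σv) (hφ : PositiveHomogeneous φ) {ρ : Fin L → Measure ℝ≥0}
    (hconv : ∀ l, RowSumsTendstoID P (lam l) 0 (ρ l))
    (hmean : ∀ l, MeanCondition P (lam l) 0 (ρ l)) (hκ : 0 < κ) (l : Fin (L + 1)) :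
    Tendsto (fun p : Fin L → ℕ => maxError P φ lam V B x p κ l) atTop (𝓝 0) := by
  obtain ⟨K, hK⟩ := hφ.exists_lipschitzWith
  induction l using Fin.induction with
  | zero => simpa only [maxError_zero] using tendsto_const_nhds
  | succ l ih =>
    obtain ⟨M, hM, hMle⟩ := h.eventually_maxMoment_le (x := x) hσv hφ hmean l.castSucc
    obtain ⟨N, hN⟩ := (hmean l).eventually_le
    have hprun : Tendsto (fun p : Fin L → ℕ =>
        ∫⁻ ω, ∑ j, prunedPart κ (fun i => lam l (p l) i ω) j ∂P) atTop (𝓝 0) :=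
      (tendsto_prunedMass (h.measurable_lam l) (h.iIndepFun_lam l) (hconv l) (hmean l) hκ).comp
        (tendsto_eval_pi_atTop l)
    have hlim : Tendsto (fun p : Fin L → ℕ => (σv : ℝ≥0∞) ^ 2 * ((K : ℝ≥0∞) ^ 2 *
        (N * maxError P φ lam V B x p κ l.castSucc +
        (∫⁻ ω, ∑ j, prunedPart κ (fun i => lam l (p l) i ω) j ∂P) * M))) atTop (𝓝 0) := by
      -- Finiteness of `N` and `M` is what makes extended multiplication continuous here, excluding
      -- ∞ · 0.
      have h1 := ENNReal.Tendsto.const_mul ih (Or.inr (ENNReal.coe_ne_top (r := N)))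
      have h2 := ENNReal.Tendsto.mul_const hprun (Or.inr hM)
      have h3 := ENNReal.Tendsto.const_mul (ENNReal.Tendsto.const_mul (h1.add h2)
        (Or.inr (ENNReal.pow_ne_top (ENNReal.coe_ne_top (r := K)) (n := 2))))
        (Or.inr (ENNReal.pow_ne_top (ENNReal.coe_ne_top (r := σv)) (n := 2)))
      simpa using h3
    refine tendsto_of_tendsto_of_tendsto_of_le_of_le' tendsto_const_nhds hlim
      (Eventually.of_forall fun _ => zero_le) ?_
    filter_upwards [hMle, (tendsto_eval_pi_atTop l).eventually hN] with p h1 h2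
    refine (h.maxError_succ_le hσv hφ hK l).trans ?_
    gcongr

end Model

end PrunedFFNN

open PrunedFFNN in
/-- The filter `atTop` on `Fin L → ℕ` is generated by the sets of `p` with all `p l ≥ N`, so it
expresses `min p → ∞`. The index `l.succ` is the layer fed by hidden layer `l`. -/
theorem mainTheorem11
    {Ω : Type*} [MeasurableSpace Ω] (P : Measure Ω) [IsProbabilityMeasure P]
    {L din : ℕ} (hdin : 0 < din) (σb σv : ℝ≥0) (hσv : 0 < σv)
    (φ : ℝ → ℝ) (hφ : PositiveHomogeneous φ)
    (μ : Fin L → ℕ → Measure ℝ≥0)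
    (lam : (l : Fin L) → (n : ℕ) → Fin n → Ω → ℝ≥0)
    (V : Fin (L + 1) → ℕ → ℕ → Ω → ℝ) (B : Fin (L + 1) → ℕ → Ω → ℝ)
    (hmodel : IsModel P σb σv μ lam V B)
    (a : Fin L → ℝ≥0) (ρ : Fin L → Measure ℝ≥0)
    (hρ : ∀ l, IsLevyMeasure (ρ l))
    (hconv : ∀ l, RowSumsTendstoID P (lam l) (a l) (ρ l))
    (ha : ∀ l, a l = 0)
    (hUI : ∀ l, MeanCondition P (lam l) (a l) (ρ l))
    (x : Fin din → ℝ) (κ : ℝ) (hκ0 : 0 < κ) (hκ1 : κ < 1) (l : Fin L) (k : ℕ) :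
    Tendsto
      (fun p : Fin L → ℕ =>
        ∫⁻ ω, ENNReal.ofReal
          (|unpruned φ lam V B x p ω l.succ k - kappaPruned φ lam V B x p κ ω l.succ k| ^ 2) ∂P)
      atTop (𝓝 0) := by
  obtain rfl : a = fun _ => 0 := funext ha
  have hsup := hmodel.tendsto_maxError (x := x) hσv hφ hconv hUI hκ0 l.succ
  refine tendsto_of_tendsto_of_tendsto_of_le_of_le tendsto_const_nhds hsup (fun _ => zero_le)
    fun p => ?_
  refine le_trans (le_of_eq (lintegral_congr fun ω => ?_)) (le_iSup (fun k : ℕ =>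
    ∫⁻ ω, ‖unpruned φ lam V B x p ω l.succ k - kappaPruned φ lam V B x p κ ω l.succ k‖ₑ ^ 2 ∂P) k)
  rw [ENNReal.ofReal_pow (abs_nonneg _), ← Real.enorm_eq_ofReal_abs]
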